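/- Notation. Let $f=\sum_{i=0}^n a_iX^i\in\mathbb{C}[X]$ with $a_n\neq 0$. Let $V(f)\subset\mathbb{C}$ be the set of distinct roots of $f$, $\mu(z)$ the multiplicity of $z$ as a root of $f$, $f^{[i]}=f^{(i)}/i!$, $\operatorname{Len}(f)=\sum_{i=0}^n|a_i|$, and for $z\in V(f)$ let $\operatorname{sep}(z,f)=\min_{y\in V(f),\,y\neq z}|y-z|$, with the convention $\operatorname{sep}(z,f)=1$ if $z$ is the only root of $f$. Let $\operatorname{Disc}(f)$ be the discriminant of $f$; up to sign, $a_n\operatorname{Disc}(f)=\operatorname{Res}(f,f')$, so that $\operatorname{Disc}(f)=\pm 1$ if $n=1$. Put $$\operatorname{logLen}(f)=\max\bigl(1,|\log \operatorname{Len}(f)|\bigr),\qquad \widehat{\operatorname{logMea}}(f)=\max\Bigl(1,\sum_{z\in V(f)}\mu(z)\log\max(1,|z|)\Bigr),$$ $$\operatorname{logsep}(f)=\max\Bigl(1,\sum_{z\in V(f)}\mu(z)\,|\log\operatorname{sep}(z,f)|\Bigr),\qquad \widehat{\operatorname{logGDisc}}(f)=\max\Bigl(1,\sum_{z\in V(f)}\mu(z)\,\bigl|\log|f^{[\mu(z)]}(z)|\bigr|\Bigr).$$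 Proposition. (a) There is an absolute constant $c>0$ such that for every $n\ge 0$ and every $f\in\mathbb{C}[X]$ of degree $n$, $$\operatorname{logsep}(f)\le c\,\Bigl(n\bigl(n+\operatorname{logLen}(f)+\widehat{\operatorname{logMea}}(f)\bigr)+\widehat{\operatorname{logGDisc}}(f)\Bigr).$$ (b) There are an absolute constant $c>0$ and an integer $k\ge 0$ such that for every $n\ge 1$ and every square-free $f\in\mathbb{C}[X]$ of degree $n$, with $T=n\bigl(\operatorname{logLen}(f)+\widehat{\operatorname{logMea}}(f)\bigr)+\bigl|\log|\operatorname{Disc}(f)|\bigr|$, $$\operatorname{logsep}(f)+\widehat{\operatorname{logGDisc}}(f)\le c\,T\,\bigl(\log(T+2)\bigr)^k,$$ that is, $\operatorname{logsep}(f)+\widehat{\operatorname{logGDisc}}(f)\in\tilde O(T)$. -/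

import Mathlib

open Polynomial

noncomputable section

namespace RootSep

/-- The length of `f`: the sum of the absolute values of its coefficients. -/
def len (f : ℂ[X]) : ℝ := ∑ i ∈ Finset.range (f.natDegree + 1), ‖f.coeff i‖

/-- The finite set of distinct complex roots of `f`. -/
def rootSet (f : ℂ[X]) : Finset ℂ := f.roots.toFinset

/-- `f^[i] = f^(i) / i!`. -/
def taylorDeriv (i : ℕ) (f : ℂ[X]) : ℂ[X] :=
  C ((Nat.factorial i : ℂ)⁻¹) * derivative^[i] f

/-- The separation of `f` at `z`: the least distance from `z` to a root of `f` other than `z`.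
When there is no such root we use the convention `sep z f = 1`, so that its logarithm is `0`. -/
def sep (z : ℂ) (f : ℂ[X]) : ℝ :=
  if h : ((rootSet f).erase z).Nonempty then
    ((rootSet f).erase z).inf' h (fun y => ‖y - z‖)
  else 1

def logLen (f : ℂ[X]) : ℝ := max 1 |Real.log (len f)|

/-- Logarithm of the Mahler measure without its leading coefficient factor, bounded below by 1. -/
def logMeaHat (f : ℂ[X]) : ℝ :=
  max 1 (∑ z ∈ rootSet f, (f.rootMultiplicity z : ℝ) * Real.log (max 1 ‖z‖))

def logsep (f : ℂ[X]) : ℝ :=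
  max 1 (∑ z ∈ rootSet f, (f.rootMultiplicity z : ℝ) * |Real.log (sep z f)|)

def logGDiscHat (f : ℂ[X]) : ℝ :=
  max 1 (∑ z ∈ rootSet f, (f.rootMultiplicity z : ℝ) *
    |Real.log ‖(taylorDeriv (f.rootMultiplicity z) f).eval z‖|)

end RootSep

end

/-! For a root `z` of multiplicity `μ`, `f^[μ](z)` is `a_n` times the product of `(z - y)^μ(y)` over
the other roots (`log_norm_taylorDeriv`). In (a), all factors but the nearest one are bounded above
by the sizes of the roots, so a tiny separation forces a tiny `f^[μ](z)` (`neg_log_sep_le`). Large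
separations are bounded by the roots, and `|log |a_n||` by the length and the Mahler measure.

In (b), that argument would lose `n` per root, hence `n^2` in all. Instead, expanding `f` at `z` to
second order gives `|f'(z)| ≤ n^2 Len(f) R^n |y - z|` for a second root `y`. When `|y - z| ≤ 1/n`
one may take `R = max(1, |z|)(1 + 1/n)`, and `(1 + 1/n)^n ≤ e`, so the loss per root is only `O(1 +
log n)` (`neg_log_sep_le_of_squarefree`). The sum of the `log |f'(z)|` is `log |Disc(f)|` up to a
multiple of `log |a_n|`, and upper bounds for single terms turn it into a bound for the sum of
absolute values. The remaining `n log n` is absorbed by `T log(T + 2)`. -/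

namespace RootSep

/-! ### Sizes of roots and upper bounds for distances between them. -/

/-- The logarithm of `max 1 ‖z‖`. -/
noncomputable def logPlus (z : ℂ) : ℝ := Real.log (max 1 ‖z‖)

lemma logPlus_nonneg (z : ℂ) : 0 ≤ logPlus z := Real.log_nonneg (le_max_left _ _)

/-- The unnormalised sum underlying `logMeaHat`. -/
noncomputable def meaSum (f : ℂ[X]) : ℝ := ∑ z ∈ rootSet f, (f.rootMultiplicity z : ℝ) * logPlus z

lemma meaSum_nonneg (f : ℂ[X]) : 0 ≤ meaSum f :=
  Finset.sum_nonneg fun z _ => mul_nonneg (Nat.cast_nonneg _) (logPlus_nonneg z)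

lemma meaSum_le (f : ℂ[X]) : meaSum f ≤ logMeaHat f := le_max_right _ _

lemma one_le_rootMultiplicity {f : ℂ[X]} {z : ℂ} (hz : z ∈ rootSet f) :
    1 ≤ f.rootMultiplicity z := by
  rw [rootSet, Multiset.mem_toFinset, mem_roots'] at hz
  exact (rootMultiplicity_pos hz.1).2 hz.2

lemma logPlus_le_meaSum {f : ℂ[X]} {z : ℂ} (hz : z ∈ rootSet f) : logPlus z ≤ meaSum f := by
  have h1 : (1 : ℝ) ≤ f.rootMultiplicity z := by exact_mod_cast one_le_rootMultiplicity hz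
  calc logPlus z ≤ (f.rootMultiplicity z : ℝ) * logPlus z :=
        le_mul_of_one_le_left (logPlus_nonneg z) h1
    _ ≤ meaSum f := Finset.single_le_sum
        (f := fun z => (f.rootMultiplicity z : ℝ) * logPlus z)
        (fun z _ => mul_nonneg (Nat.cast_nonneg _) (logPlus_nonneg z)) hz

lemma sum_rootMultiplicity (f : ℂ[X]) :
    ∑ z ∈ rootSet f, (f.rootMultiplicity z : ℝ) = f.natDegree := by
  have h := Multiset.toFinset_sum_count_eq f.roots
  rw [← (IsAlgClosed.splits f).natDegree_eq_card_roots] at h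
  rw [← h]
  push_cast
  simp [rootSet, count_roots]

lemma log_two_le_one : Real.log 2 ≤ 1 := by
  have := Real.log_two_lt_d9
  linarith

lemma log_norm_sub_le (y z : ℂ) : Real.log ‖y - z‖ ≤ 1 + logPlus y + logPlus z := by
  have hy : 1 ≤ max 1 ‖y‖ := le_max_left _ _
  have hz : 1 ≤ max 1 ‖z‖ := le_max_left _ _
  rcases eq_or_ne y z with rfl | h
  · have := logPlus_nonneg y
    simp
    linarith
  have hle : ‖y - z‖ ≤ 2 * max 1 ‖y‖ * max 1 ‖z‖ := by
    have h1 := norm_sub_le y z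
    have h2 : ‖y‖ ≤ max 1 ‖y‖ := le_max_right _ _
    have h3 : ‖z‖ ≤ max 1 ‖z‖ := le_max_right _ _
    nlinarith
  have hl := Real.log_le_log (norm_pos_iff.2 (sub_ne_zero.2 h)) hle
  rw [Real.log_mul (by positivity) (by positivity), Real.log_mul (by positivity) (by positivity)]
    at hl
  have := log_two_le_one
  unfold logPlus
  linarith

lemma sep_eq_one {f : ℂ[X]} {z : ℂ} (h : ¬ ((rootSet f).erase z).Nonempty) : sep z f = 1 := by
  simp [sep, h]

lemma exists_sep_eq {f : ℂ[X]} {z : ℂ} (h : ((rootSet f).erase z).Nonempty) :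
    ∃ y ∈ (rootSet f).erase z, sep z f = ‖y - z‖ := by
  rw [sep, dif_pos h]
  exact Finset.exists_mem_eq_inf' h _

lemma log_sep_le {f : ℂ[X]} {z : ℂ} : Real.log (sep z f) ≤ 1 + logPlus z + meaSum f := by
  have h1 := logPlus_nonneg z
  have h2 := meaSum_nonneg f
  by_cases h : ((rootSet f).erase z).Nonempty
  · obtain ⟨y, hy, hs⟩ := exists_sep_eq h
    have := log_norm_sub_le y z
    have := logPlus_le_meaSum (Finset.mem_of_mem_erase hy)
    rw [hs]
    linarith
  · rw [sep_eq_one h, Real.log_one]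
    linarith

/-! ### Generalised derivatives as products of root differences. -/

lemma eq_C_mul_prod (f : ℂ[X]) :
    f = C f.leadingCoeff * ∏ y ∈ rootSet f, (X - C y) ^ f.rootMultiplicity y := by
  conv_lhs => rw [(IsAlgClosed.splits f).eq_prod_roots]
  rw [Finset.prod_multiset_map_count]
  simp [rootSet, count_roots]

lemma eval_taylorDeriv_rootMultiplicity {f : ℂ[X]} {z : ℂ} (hz : z ∈ rootSet f) :
    (taylorDeriv (f.rootMultiplicity z) f).eval z =
      f.leadingCoeff * ∏ y ∈ (rootSet f).erase z, (z - y) ^ f.rootMultiplicity y := by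
  have hfac : ((f.rootMultiplicity z).factorial : ℂ) ≠ 0 := by
    exact_mod_cast Nat.factorial_ne_zero _
  have hq : f /ₘ (X - C z) ^ f.rootMultiplicity z =
      C f.leadingCoeff * ∏ y ∈ (rootSet f).erase z, (X - C y) ^ f.rootMultiplicity y := by
    have h := eq_C_mul_prod f
    rw [← Finset.mul_prod_erase _ _ hz, mul_left_comm] at h
    have hc := mul_divByMonic_cancel_left
      (C f.leadingCoeff * ∏ y ∈ (rootSet f).erase z, (X - C y) ^ f.rootMultiplicity y)
      ((monic_X_sub_C z).pow (f.rootMultiplicity z))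
    rwa [← h] at hc
  rw [taylorDeriv, eval_mul, eval_C, eval_iterate_derivative_rootMultiplicity, hq, nsmul_eq_mul,
    inv_mul_cancel_left₀ hfac, eval_mul, eval_C, eval_prod]
  simp

lemma log_norm_taylorDeriv {f : ℂ[X]} (hf : f ≠ 0) {z : ℂ} (hz : z ∈ rootSet f) :
    Real.log ‖(taylorDeriv (f.rootMultiplicity z) f).eval z‖ =
      Real.log ‖f.leadingCoeff‖ +
        ∑ y ∈ (rootSet f).erase z, (f.rootMultiplicity y : ℝ) * Real.log ‖y - z‖ := by
  have hne : ∀ y ∈ (rootSet f).erase z, ‖z - y‖ ^ f.rootMultiplicity y ≠ 0 := fun y hy =>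
    pow_ne_zero _ (norm_ne_zero_iff.2 (sub_ne_zero.2 (Finset.ne_of_mem_erase hy).symm))
  rw [eval_taylorDeriv_rootMultiplicity hz, norm_mul, norm_prod]
  simp_rw [norm_pow]
  rw [Real.log_mul (norm_ne_zero_iff.2 (leadingCoeff_ne_zero.2 hf)) (Finset.prod_ne_zero_iff.2 hne),
    Real.log_prod hne]
  simp_rw [Real.log_pow, norm_sub_rev z]

lemma neg_log_sep_le {f : ℂ[X]} (hf : f ≠ 0) {z : ℂ} (hz : z ∈ rootSet f) :
    -Real.log (sep z f) ≤ |Real.log ‖(taylorDeriv (f.rootMultiplicity z) f).eval z‖| +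
      |Real.log ‖f.leadingCoeff‖| + f.natDegree + f.natDegree * logPlus z + meaSum f := by
  have h1 := logPlus_nonneg z
  have h2 := meaSum_nonneg f
  rcases le_total 0 (Real.log (sep z f)) with h0 | h0
  · have : (0 : ℝ) ≤ |Real.log ‖(taylorDeriv (f.rootMultiplicity z) f).eval z‖| +
      |Real.log ‖f.leadingCoeff‖| + f.natDegree + f.natDegree * logPlus z + meaSum f := by
      positivity
    linarith
  by_cases h : ((rootSet f).erase z).Nonempty
  swap
  · rw [sep_eq_one h, Real.log_one, neg_zero]
    positivity
  obtain ⟨w, hw, hs⟩ := exists_sep_eq h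
  -- The nearest root `w` keeps one copy of `log (sep z f)`: this is nonpositive here, so a
  -- multiplicity at least 1 only helps.
  have key : ∑ y ∈ (rootSet f).erase z, (f.rootMultiplicity y : ℝ) * Real.log ‖y - z‖ ≤
      ∑ y ∈ (rootSet f).erase z, ((f.rootMultiplicity y : ℝ) * (1 + logPlus y + logPlus z) +
        if y = w then Real.log (sep z f) else 0) := by
    refine Finset.sum_le_sum fun y hy => ?_
    have hm : (1 : ℝ) ≤ f.rootMultiplicity y := by
      exact_mod_cast one_le_rootMultiplicity (Finset.mem_of_mem_erase hy)
    have hy0 := logPlus_nonneg y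
    split_ifs with hyw
    · subst hyw
      rw [hs] at h0 ⊢
      nlinarith [mul_nonneg (sub_nonneg.2 hm) (neg_nonneg.2 h0)]
    · rw [add_zero]
      exact mul_le_mul_of_nonneg_left (log_norm_sub_le y z) (by linarith)
  rw [Finset.sum_add_distrib, Finset.sum_ite_eq' , if_pos hw] at key
  have hsub : ∑ y ∈ (rootSet f).erase z,
      (f.rootMultiplicity y : ℝ) * (1 + logPlus y + logPlus z) ≤
      f.natDegree + f.natDegree * logPlus z + meaSum f := by
    calc _ ≤ ∑ y ∈ rootSet f, (f.rootMultiplicity y : ℝ) * (1 + logPlus y + logPlus z) :=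
          Finset.sum_le_sum_of_subset_of_nonneg (Finset.erase_subset _ _) fun y _ _ => by
            have := logPlus_nonneg y
            positivity
      _ = f.natDegree + f.natDegree * logPlus z + meaSum f := by
          rw [← sum_rootMultiplicity f, Finset.sum_mul, meaSum, ← Finset.sum_add_distrib,
            ← Finset.sum_add_distrib]
          exact Finset.sum_congr rfl fun y _ => by ring
  have hlog := log_norm_taylorDeriv hf hz
  have := neg_abs_le (Real.log ‖(taylorDeriv (f.rootMultiplicity z) f).eval z‖)
  have := le_abs_self (Real.log ‖f.leadingCoeff‖)
  linarith

/-! ### Length, Mahler measure and leading coefficient. -/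

lemma norm_leadingCoeff_le_len (f : ℂ[X]) : ‖f.leadingCoeff‖ ≤ len f :=
  Finset.single_le_sum (f := fun i => ‖f.coeff i‖) (fun _ _ => norm_nonneg _)
    (Finset.mem_range.2 (Nat.lt_succ_self _))

lemma len_pos {f : ℂ[X]} (hf : f ≠ 0) : 0 < len f :=
  (norm_pos_iff.2 (leadingCoeff_ne_zero.2 hf)).trans_le (norm_leadingCoeff_le_len f)

lemma len_le_two_pow_mul_mahlerMeasure (f : ℂ[X]) :
    len f ≤ 2 ^ f.natDegree * f.mahlerMeasure := by
  calc len f ≤ ∑ i ∈ Finset.range (f.natDegree + 1),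
        (f.natDegree.choose i : ℝ) * f.mahlerMeasure :=
        Finset.sum_le_sum fun i _ => norm_coeff_le_choose_mul_mahlerMeasure i f
    _ = 2 ^ f.natDegree * f.mahlerMeasure := by
        rw [← Finset.sum_mul]
        congr 1
        exact_mod_cast Nat.sum_range_choose f.natDegree

lemma log_mahlerMeasure (f : ℂ[X]) :
    Real.log f.mahlerMeasure = Real.log ‖f.leadingCoeff‖ + meaSum f := by
  rw [← logMahlerMeasure_eq_log_MahlerMeasure, logMahlerMeasure_eq_log_leadingCoeff_add_sum_log_roots,
    Finset.sum_multiset_map_count]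
  simp [meaSum, rootSet, count_roots, logPlus, Real.posLog_eq_log_max_one]

lemma abs_log_len_le (f : ℂ[X]) : |Real.log (len f)| ≤ logLen f := le_max_right _ _

lemma log_norm_leadingCoeff_le {f : ℂ[X]} (hf : f ≠ 0) :
    Real.log ‖f.leadingCoeff‖ ≤ logLen f :=
  (Real.log_le_log (norm_pos_iff.2 (leadingCoeff_ne_zero.2 hf)) (norm_leadingCoeff_le_len f)).trans
    ((le_abs_self _).trans (abs_log_len_le f))

/-- The lower bound on `|a_n|` comes from `Len(f) ≤ 2^n M(f)`, where `M(f)` is `|a_n|` times the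
root part. -/
lemma abs_log_norm_leadingCoeff_le {f : ℂ[X]} (hf : f ≠ 0) :
    |Real.log ‖f.leadingCoeff‖| ≤ logLen f + f.natDegree + meaSum f := by
  have h := Real.log_le_log (len_pos hf) (len_le_two_pow_mul_mahlerMeasure f)
  rw [Real.log_mul (by positivity) (mahlerMeasure_pos_of_ne_zero hf).ne', log_mahlerMeasure,
    Real.log_pow] at h
  have h2 : (f.natDegree : ℝ) * Real.log 2 ≤ f.natDegree :=
    mul_le_of_le_one_right (Nat.cast_nonneg _) log_two_le_one
  have h3 := neg_abs_le (Real.log (len f))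
  have h4 := abs_log_len_le f
  have h5 := log_norm_leadingCoeff_le hf
  have h6 := meaSum_nonneg f
  have h7 : (0 : ℝ) ≤ f.natDegree := Nat.cast_nonneg _
  rw [abs_le]
  constructor <;> linarith

/-! ### Part (a): summation over the roots. -/

theorem logsep_le {f : ℂ[X]} (hf : f ≠ 0) :
    logsep f ≤ 5 * ((f.natDegree : ℝ) * (f.natDegree + logLen f + logMeaHat f)
      + logGDiscHat f) := by
  have hn : (0 : ℝ) ≤ f.natDegree := Nat.cast_nonneg _
  have hL : 1 ≤ logLen f := le_max_left _ _
  have hM : 1 ≤ logMeaHat f := le_max_left _ _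
  have hG : 1 ≤ logGDiscHat f := le_max_left _ _
  have hG' : _ ≤ logGDiscHat f := le_max_right _ _
  have hS := meaSum_nonneg f
  have hSM := meaSum_le f
  have hA := abs_log_norm_leadingCoeff_le hf
  have hprod : 0 ≤ (f.natDegree : ℝ) * (f.natDegree + logLen f + logMeaHat f) := by positivity
  refine max_le (by linarith) ?_
  have key : ∑ z ∈ rootSet f, (f.rootMultiplicity z : ℝ) * |Real.log (sep z f)| ≤
      ∑ z ∈ rootSet f, ((f.rootMultiplicity z : ℝ) *
          |Real.log ‖(taylorDeriv (f.rootMultiplicity z) f).eval z‖| +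
        (f.rootMultiplicity z : ℝ) * (|Real.log ‖f.leadingCoeff‖| + f.natDegree + 1 +
          2 * meaSum f) +
        ((f.natDegree : ℝ) + 1) * ((f.rootMultiplicity z : ℝ) * logPlus z)) := by
    refine Finset.sum_le_sum fun z hz => ?_
    have h1 := neg_log_sep_le hf hz
    have h2 := log_sep_le (f := f) (z := z)
    have h3 := logPlus_nonneg z
    have h4 : 0 ≤ (f.natDegree : ℝ) * logPlus z := by positivity
    have h5 := abs_nonneg (Real.log ‖(taylorDeriv (f.rootMultiplicity z) f).eval z‖)
    have h6 := abs_nonneg (Real.log ‖f.leadingCoeff‖)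
    have : |Real.log (sep z f)| ≤ |Real.log ‖(taylorDeriv (f.rootMultiplicity z) f).eval z‖| +
        (|Real.log ‖f.leadingCoeff‖| + f.natDegree + 1 + 2 * meaSum f) +
        ((f.natDegree : ℝ) + 1) * logPlus z := by
      rw [abs_le]
      constructor <;> linarith
    calc _ ≤ (f.rootMultiplicity z : ℝ) * _ :=
          mul_le_mul_of_nonneg_left this (Nat.cast_nonneg _)
      _ = _ := by ring
  rw [Finset.sum_add_distrib, Finset.sum_add_distrib, ← Finset.sum_mul, ← Finset.mul_sum,
    sum_rootMultiplicity] at key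
  change _ ≤ _ + _ + _ * meaSum f at key
  have hnn : (f.natDegree : ℝ) ≤ (f.natDegree : ℝ) * f.natDegree := by
    rcases Nat.eq_zero_or_pos f.natDegree with h | h
    · simp [h]
    · exact le_mul_of_one_le_left hn (by exact_mod_cast h)
  -- Degree 0 is allowed: the bound by `n * meaSum f` survives because there are no roots.
  have hSn : f.natDegree = 0 → meaSum f = 0 := fun h => by
    have : rootSet f = ∅ := by
      rw [rootSet, Multiset.toFinset_eq_empty, ← Multiset.card_eq_zero,
        ← (IsAlgClosed.splits f).natDegree_eq_card_roots, h]
    simp [meaSum, this]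
  have hSn' : meaSum f ≤ f.natDegree * meaSum f := by
    rcases Nat.eq_zero_or_pos f.natDegree with h | h
    · simp [hSn h]
    · exact le_mul_of_one_le_left hS (by exact_mod_cast h)
  nlinarith [mul_le_mul_of_nonneg_left hA hn, mul_le_mul_of_nonneg_left hSM hn,
    mul_nonneg hn hS, mul_nonneg hn (zero_le_one.trans hL)]

/-! ### Square-free polynomials: derivatives at the roots and the discriminant. -/

lemma rootMultiplicity_eq_one {f : ℂ[X]} (hsq : Squarefree f) {z : ℂ} (hz : z ∈ rootSet f) :
    f.rootMultiplicity z = 1 := by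
  refine le_antisymm ?_ (one_le_rootMultiplicity hz)
  rw [← count_roots]
  exact Multiset.nodup_iff_count_le_one.1
    (nodup_roots (PerfectField.separable_iff_squarefree.2 hsq)) z

lemma taylorDeriv_one (f : ℂ[X]) : taylorDeriv 1 f = derivative f := by
  simp [taylorDeriv]

lemma eval_derivative_ne_zero {f : ℂ[X]} (hsq : Squarefree f) {z : ℂ} (hz : z ∈ rootSet f) :
    (derivative f).eval z ≠ 0 := by
  rw [rootSet, Multiset.mem_toFinset, mem_roots'] at hz
  have h := (PerfectField.separable_iff_squarefree.2 hsq).aeval_derivative_ne_zero (x := z)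
    (by simpa using hz.2)
  simpa using h

lemma sum_log_norm_eval_derivative {f : ℂ[X]} (hsq : Squarefree f) (hn : 1 ≤ f.natDegree) :
    ∑ z ∈ rootSet f, Real.log ‖(derivative f).eval z‖ =
      Real.log ‖f.discr‖ - ((f.natDegree : ℝ) - 2) * Real.log ‖f.leadingCoeff‖ := by
  have hf : f ≠ 0 := hsq.ne_zero
  have ha : ‖f.leadingCoeff‖ ≠ 0 := norm_ne_zero_iff.2 (leadingCoeff_ne_zero.2 hf)
  have hd : ∀ z ∈ rootSet f, ‖(derivative f).eval z‖ ≠ 0 := fun z hz =>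
    norm_ne_zero_iff.2 (eval_derivative_ne_zero hsq hz)
  have hnodup : f.roots.Nodup := nodup_roots (PerfectField.separable_iff_squarefree.2 hsq)
  have h := resultant_eq_prod_eval f (derivative f) (f.natDegree - 1) (natDegree_derivative_le f)
    (IsAlgClosed.splits f)
  rw [resultant_deriv (natDegree_pos_iff_degree_pos.1 hn)] at h
  have hprod : (f.roots.map (fun z => (derivative f).eval z)).prod =
      ∏ z ∈ rootSet f, (derivative f).eval z := by
    rw [Finset.prod, rootSet, Multiset.toFinset_val, hnodup.dedup]
  have h' := congrArg norm (h.trans (congrArg _ hprod))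
  simp only [norm_mul, norm_pow, norm_neg, norm_one, one_pow, one_mul, norm_prod] at h'
  have hP : ∏ z ∈ rootSet f, ‖(derivative f).eval z‖ ≠ 0 := Finset.prod_ne_zero_iff.2 hd
  have hD : ‖f.discr‖ ≠ 0 := by
    intro h0
    rw [h0, mul_zero] at h'
    exact mul_ne_zero (pow_ne_zero _ ha) hP h'.symm
  have hl := congrArg Real.log h'
  rw [Real.log_mul ha hD, Real.log_mul (pow_ne_zero _ ha) hP, Real.log_pow, Real.log_prod hd,
    Nat.cast_sub hn, Nat.cast_one] at hl
  linarith

/-! ### Second-order expansion at a root. -/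

lemma norm_pow_sub_pow_sub_le {y z : ℂ} {R : ℝ} (hR : 1 ≤ R) (hy : ‖y‖ ≤ R) (hz : ‖z‖ ≤ R)
    (i : ℕ) :
    ‖y ^ i - z ^ i - i * z ^ (i - 1) * (y - z)‖ ≤ i ^ 2 * R ^ i * ‖y - z‖ ^ 2 := by
  induction i with
  | zero => simp
  | succ i ih =>
    have hR0 : 0 ≤ R := zero_le_one.trans hR
    have heq : y ^ (i + 1) - z ^ (i + 1) - ((i + 1 : ℕ) : ℂ) * z ^ (i + 1 - 1) * (y - z) =
        y * (y ^ i - z ^ i - i * z ^ (i - 1) * (y - z)) +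
          i * z ^ (i - 1) * (y - z) ^ 2 := by
      rcases i with _ | i
      · simp
      · simp only [Nat.add_sub_cancel]
        push_cast
        ring
    have hpow : ‖z‖ ^ (i - 1) ≤ R ^ (i + 1) :=
      (pow_le_pow_left₀ (norm_nonneg _) hz _).trans (pow_le_pow_right₀ hR (by omega))
    rw [heq]
    calc _ ≤ ‖y‖ * ‖y ^ i - z ^ i - i * z ^ (i - 1) * (y - z)‖ +
          i * ‖z‖ ^ (i - 1) * ‖y - z‖ ^ 2 := by
          refine (norm_add_le _ _).trans ?_
          simp
      _ ≤ R * (i ^ 2 * R ^ i * ‖y - z‖ ^ 2) + i * R ^ (i + 1) * ‖y - z‖ ^ 2 := by gcongr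
      _ = (i ^ 2 + i) * (R ^ (i + 1) * ‖y - z‖ ^ 2) := by ring
      _ ≤ ((i + 1 : ℕ) ^ 2) * (R ^ (i + 1) * ‖y - z‖ ^ 2) := by
          gcongr
          push_cast
          nlinarith [Nat.cast_nonneg (α := ℝ) i]
      _ = _ := by ring

lemma eval_derivative_eq_sum (f : ℂ[X]) (z : ℂ) :
    (derivative f).eval z =
      ∑ i ∈ Finset.range (f.natDegree + 1), f.coeff i * (i * z ^ (i - 1)) := by
  rw [derivative_eval, sum_over_range _ (by simp)]
  exact Finset.sum_congr rfl fun i _ => by ring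

lemma norm_eval_derivative_le (f : ℂ[X]) (z : ℂ) :
    ‖(derivative f).eval z‖ ≤ f.natDegree * len f * max 1 ‖z‖ ^ f.natDegree := by
  rw [eval_derivative_eq_sum, len, Finset.mul_sum, Finset.sum_mul]
  refine (norm_sum_le _ _).trans (Finset.sum_le_sum fun i hi => ?_)
  have hi' : i ≤ f.natDegree := Nat.lt_succ_iff.1 (Finset.mem_range.1 hi)
  have h1 : ‖z‖ ^ (i - 1) ≤ max 1 ‖z‖ ^ f.natDegree :=
    (pow_le_pow_left₀ (norm_nonneg _) (le_max_right 1 _) _).trans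
      (pow_le_pow_right₀ (le_max_left _ _) (by omega))
  calc ‖f.coeff i * (i * z ^ (i - 1))‖ = ‖f.coeff i‖ * (i * ‖z‖ ^ (i - 1)) := by simp
    _ ≤ ‖f.coeff i‖ * (f.natDegree * max 1 ‖z‖ ^ f.natDegree) := by gcongr
    _ = _ := by ring

/-- If `y ≠ z` are roots of `f` in the disc of radius `R ≥ 1`, then `f'(z)` is small when `y` is
close to `z`. -/
lemma norm_eval_derivative_le_of_roots {f : ℂ[X]} {y z : ℂ} (hyz : y ≠ z) (hfy : f.eval y = 0)
    (hfz : f.eval z = 0) {R : ℝ} (hR : 1 ≤ R) (hy : ‖y‖ ≤ R) (hz : ‖z‖ ≤ R) :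
    ‖(derivative f).eval z‖ ≤ f.natDegree ^ 2 * len f * R ^ f.natDegree * ‖y - z‖ := by
  have hpos : 0 < ‖y - z‖ := norm_pos_iff.2 (sub_ne_zero.2 hyz)
  have heq : (derivative f).eval z * (y - z) = -∑ i ∈ Finset.range (f.natDegree + 1),
      f.coeff i * (y ^ i - z ^ i - i * z ^ (i - 1) * (y - z)) := by
    rw [eval_eq_sum_range] at hfy hfz
    simp_rw [mul_sub, Finset.sum_sub_distrib, hfy, hfz]
    rw [eval_derivative_eq_sum, sub_zero, zero_sub, ← mul_sub, Finset.sum_mul]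
    simp [mul_sub, mul_assoc]
  have h2 : ‖(derivative f).eval z‖ * ‖y - z‖ ≤
      (f.natDegree ^ 2 * len f * R ^ f.natDegree * ‖y - z‖) * ‖y - z‖ := by
    rw [← norm_mul, heq, norm_neg, len, Finset.mul_sum, Finset.sum_mul, Finset.sum_mul,
      Finset.sum_mul]
    refine (norm_sum_le _ _).trans (Finset.sum_le_sum fun i hi => ?_)
    have hi' : i ≤ f.natDegree := Nat.lt_succ_iff.1 (Finset.mem_range.1 hi)
    have hR0 : 0 ≤ R := zero_le_one.trans hR
    rw [norm_mul]
    calc _ ≤ ‖f.coeff i‖ * (i ^ 2 * R ^ i * ‖y - z‖ ^ 2) := by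
          gcongr
          exact norm_pow_sub_pow_sub_le hR hy hz i
      _ ≤ ‖f.coeff i‖ * (f.natDegree ^ 2 * R ^ f.natDegree * ‖y - z‖ ^ 2) := by gcongr
      _ = _ := by ring
  exact le_of_mul_le_mul_right h2 hpos

lemma log_norm_eval_derivative_le {f : ℂ[X]} (hsq : Squarefree f) (hn : 1 ≤ f.natDegree) {z : ℂ}
    (hz : z ∈ rootSet f) :
    Real.log ‖(derivative f).eval z‖ ≤
      Real.log f.natDegree + logLen f + f.natDegree * logPlus z := by
  have hn0 : (0 : ℝ) < f.natDegree := by exact_mod_cast hn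
  have hl := len_pos hsq.ne_zero
  have h := Real.log_le_log (norm_pos_iff.2 (eval_derivative_ne_zero hsq hz))
    (norm_eval_derivative_le f z)
  rw [Real.log_mul (by positivity) (by positivity), Real.log_mul hn0.ne' hl.ne', Real.log_pow] at h
  have h1 := (le_abs_self _).trans (abs_log_len_le f)
  unfold logPlus
  linarith

lemma neg_log_sep_le_of_squarefree {f : ℂ[X]} (hsq : Squarefree f) (hn : 1 ≤ f.natDegree) {z : ℂ}
    (hz : z ∈ rootSet f) :
    -Real.log (sep z f) ≤ |Real.log ‖(derivative f).eval z‖| + 1 + 2 * Real.log f.natDegree +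
      logLen f + f.natDegree * logPlus z := by
  have hn1 : (1 : ℝ) ≤ f.natDegree := by exact_mod_cast hn
  have hn0 : (0 : ℝ) < f.natDegree := by linarith
  have hlogn := Real.log_nonneg hn1
  have hp := logPlus_nonneg z
  have hL : 1 ≤ logLen f := le_max_left _ _
  have hnp : 0 ≤ (f.natDegree : ℝ) * logPlus z := by positivity
  have habs := abs_nonneg (Real.log ‖(derivative f).eval z‖)
  by_cases h : ((rootSet f).erase z).Nonempty
  swap
  · rw [sep_eq_one h, Real.log_one]
    linarith
  obtain ⟨y, hy, hs⟩ := exists_sep_eq h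
  have hyz := Finset.ne_of_mem_erase hy
  have hsep : 0 < ‖y - z‖ := norm_pos_iff.2 (sub_ne_zero.2 hyz)
  have hfy : f.eval y = 0 :=
    (mem_roots'.1 (Multiset.mem_toFinset.1 (Finset.mem_of_mem_erase hy))).2
  have hfz : f.eval z = 0 := (mem_roots'.1 (Multiset.mem_toFinset.1 hz)).2
  rw [hs]
  -- Beyond distance `1/n` the bound `log n` suffices; within it, both roots lie in a disc whose
  -- radius exceeds `max 1 ‖z‖` by a factor at most `1 + 1/n`.
  rcases le_total ((f.natDegree : ℝ)⁻¹) ‖y - z‖ with hfar | hnear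
  · have := Real.log_le_log (inv_pos.2 hn0) hfar
    rw [Real.log_inv] at this
    linarith
  · have hl := len_pos hsq.ne_zero
    have hm : 1 ≤ max 1 ‖z‖ := le_max_left _ _
    have hinv : 0 ≤ (f.natDegree : ℝ)⁻¹ := inv_nonneg.2 hn0.le
    have hR : max 1 ‖z‖ + (f.natDegree : ℝ)⁻¹ ≤ max 1 ‖z‖ * (1 + (f.natDegree : ℝ)⁻¹) := by
      nlinarith
    have hzm : ‖z‖ ≤ max 1 ‖z‖ := le_max_right _ _
    have hyR : ‖y‖ ≤ max 1 ‖z‖ * (1 + (f.natDegree : ℝ)⁻¹) := by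
      have := norm_le_norm_add_norm_sub' y z
      linarith
    have hb := norm_eval_derivative_le_of_roots hyz hfy hfz (by linarith) hyR (by linarith)
    have hlog := Real.log_le_log (norm_pos_iff.2 (eval_derivative_ne_zero hsq hz)) hb
    rw [Real.log_mul (by positivity) hsep.ne', Real.log_mul (by positivity) (by positivity),
      Real.log_mul (by positivity) hl.ne', Real.log_pow, Real.log_pow,
      Real.log_mul (by positivity) (by positivity)] at hlog
    have h1 : Real.log (1 + (f.natDegree : ℝ)⁻¹) ≤ (f.natDegree : ℝ)⁻¹ := by
      have := Real.log_le_sub_one_of_pos (x := 1 + (f.natDegree : ℝ)⁻¹) (by positivity)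
      linarith
    have h2 : (f.natDegree : ℝ) * Real.log (1 + (f.natDegree : ℝ)⁻¹) ≤ 1 :=
      (mul_le_mul_of_nonneg_left h1 hn0.le).trans_eq (mul_inv_cancel₀ hn0.ne')
    have h3 := (le_abs_self _).trans (abs_log_len_le f)
    have h4 := neg_abs_le (Real.log ‖(derivative f).eval z‖)
    unfold logPlus
    push_cast at hlog
    linarith

/-! ### Part (b): summation over the roots. -/

lemma meaSum_eq_of_squarefree {f : ℂ[X]} (hsq : Squarefree f) :
    meaSum f = ∑ z ∈ rootSet f, logPlus z :=
  Finset.sum_congr rfl fun z hz => by rw [rootMultiplicity_eq_one hsq hz, Nat.cast_one, one_mul]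

lemma card_rootSet_of_squarefree {f : ℂ[X]} (hsq : Squarefree f) :
    ((rootSet f).card : ℝ) = f.natDegree := by
  rw [← sum_rootMultiplicity f, Finset.card_eq_sum_ones]
  push_cast
  exact Finset.sum_congr rfl fun z hz => by rw [rootMultiplicity_eq_one hsq hz, Nat.cast_one]

lemma sum_abs_log_norm_eval_derivative_le {f : ℂ[X]} (hsq : Squarefree f)
    (hn : 1 ≤ f.natDegree) :
    ∑ z ∈ rootSet f, |Real.log ‖(derivative f).eval z‖| ≤
      3 * f.natDegree * logLen f + 3 * f.natDegree * meaSum f +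
        2 * f.natDegree * Real.log f.natDegree + f.natDegree + |Real.log ‖f.discr‖| := by
  have hn1 : (1 : ℝ) ≤ f.natDegree := by exact_mod_cast hn
  have hlogn := Real.log_nonneg hn1
  have hL : 1 ≤ logLen f := le_max_left _ _
  have hS := meaSum_nonneg f
  -- If `x ≤ B` and `0 ≤ B`, then `|x| ≤ 2B - x`; the signed sum is then known from the
  -- discriminant.
  have key : ∑ z ∈ rootSet f, |Real.log ‖(derivative f).eval z‖| ≤
      ∑ z ∈ rootSet f, (2 * (Real.log f.natDegree + logLen f) + 2 * f.natDegree * logPlus z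
        - Real.log ‖(derivative f).eval z‖) := by
    refine Finset.sum_le_sum fun z hz => ?_
    have h1 := log_norm_eval_derivative_le hsq hn hz
    have h2 : 0 ≤ (f.natDegree : ℝ) * logPlus z := mul_nonneg (by linarith) (logPlus_nonneg z)
    rw [abs_le]
    constructor <;> linarith
  rw [Finset.sum_sub_distrib, Finset.sum_add_distrib, ← Finset.mul_sum, ← Finset.mul_sum,
    ← meaSum_eq_of_squarefree hsq, sum_log_norm_eval_derivative hsq hn, Finset.sum_const,
    nsmul_eq_mul, card_rootSet_of_squarefree hsq] at key
  have hD := neg_abs_le (Real.log ‖f.discr‖)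
  have hA : ((f.natDegree : ℝ) - 2) * Real.log ‖f.leadingCoeff‖ ≤
      f.natDegree * logLen f + f.natDegree * meaSum f + f.natDegree := by
    have hnL : 0 ≤ (f.natDegree : ℝ) * logLen f := by positivity
    have hnS : 0 ≤ (f.natDegree : ℝ) * meaSum f := by positivity
    -- For `n = 1` the factor `n - 2` is negative, so a lower bound on `log |a_n|` is needed instead
    -- of an upper one.
    rcases hn.eq_or_lt with h | h
    · have h1 := abs_log_norm_leadingCoeff_le hsq.ne_zero
      have h2 := neg_abs_le (Real.log ‖f.leadingCoeff‖)
      rw [← h] at h1 ⊢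
      push_cast at h1 ⊢
      linarith
    · have h2 : (2 : ℝ) ≤ f.natDegree := by exact_mod_cast h
      have h3 := mul_le_mul_of_nonneg_left (log_norm_leadingCoeff_le hsq.ne_zero)
        (sub_nonneg.2 h2)
      linarith
  linarith

lemma sum_abs_log_sep_le {f : ℂ[X]} (hsq : Squarefree f) (hn : 1 ≤ f.natDegree) :
    ∑ z ∈ rootSet f, |Real.log (sep z f)| ≤
      ∑ z ∈ rootSet f, |Real.log ‖(derivative f).eval z‖| + 2 * f.natDegree +
        2 * f.natDegree * Real.log f.natDegree + f.natDegree * logLen f +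
        3 * f.natDegree * meaSum f := by
  have hn1 : (1 : ℝ) ≤ f.natDegree := by exact_mod_cast hn
  have hlogn := Real.log_nonneg hn1
  have hL : 1 ≤ logLen f := le_max_left _ _
  have hS := meaSum_nonneg f
  have key : ∑ z ∈ rootSet f, |Real.log (sep z f)| ≤
      ∑ z ∈ rootSet f, (|Real.log ‖(derivative f).eval z‖| +
        (2 + 2 * Real.log f.natDegree + logLen f + meaSum f) +
        (f.natDegree + 1) * logPlus z) := by
    refine Finset.sum_le_sum fun z hz => ?_
    have h1 := neg_log_sep_le_of_squarefree hsq hn hz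
    have h2 := log_sep_le (f := f) (z := z)
    have h3 := logPlus_nonneg z
    have h4 : 0 ≤ (f.natDegree : ℝ) * logPlus z := mul_nonneg (by linarith) h3
    have h5 := abs_nonneg (Real.log ‖(derivative f).eval z‖)
    rw [abs_le]
    constructor <;> linarith
  rw [Finset.sum_add_distrib, Finset.sum_add_distrib, ← Finset.mul_sum,
    ← meaSum_eq_of_squarefree hsq, Finset.sum_const, nsmul_eq_mul,
    card_rootSet_of_squarefree hsq] at key
  nlinarith [le_mul_of_one_le_left hS hn1]

theorem logsep_add_logGDiscHat_le {f : ℂ[X]} (hsq : Squarefree f) (hn : 1 ≤ f.natDegree) {T : ℝ}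
    (hT : T = f.natDegree * (logLen f + logMeaHat f) + |Real.log ‖f.discr‖|) :
    logsep f + logGDiscHat f ≤ 15 * T * Real.log (T + 2) := by
  have hn1 : (1 : ℝ) ≤ f.natDegree := by exact_mod_cast hn
  have hL : 1 ≤ logLen f := le_max_left _ _
  have hM : 1 ≤ logMeaHat f := le_max_left _ _
  have hS := meaSum_nonneg f
  have hnS := mul_le_mul_of_nonneg_left (meaSum_le f) (zero_le_one.trans hn1)
  have hnL := mul_le_mul_of_nonneg_left hL (zero_le_one.trans hn1)
  have hnM := mul_le_mul_of_nonneg_left hM (zero_le_one.trans hn1)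
  have hD := abs_nonneg (Real.log ‖f.discr‖)
  have hlogn := Real.log_nonneg hn1
  have hTn : 2 * (f.natDegree : ℝ) ≤ T := by linarith
  have hlogT : Real.log f.natDegree ≤ Real.log (T + 2) :=
    Real.log_le_log (by linarith) (by linarith)
  have hlog1 : 1 ≤ Real.log (T + 2) := by
    rw [Real.le_log_iff_exp_le (by linarith)]
    have := Real.exp_one_lt_d9
    linarith
  have hsep : ∑ z ∈ rootSet f, (f.rootMultiplicity z : ℝ) * |Real.log (sep z f)| =
      ∑ z ∈ rootSet f, |Real.log (sep z f)| :=
    Finset.sum_congr rfl fun z hz => by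
      rw [rootMultiplicity_eq_one hsq hz, Nat.cast_one, one_mul]
  have hgd : ∑ z ∈ rootSet f, (f.rootMultiplicity z : ℝ) *
      |Real.log ‖(taylorDeriv (f.rootMultiplicity z) f).eval z‖| =
      ∑ z ∈ rootSet f, |Real.log ‖(derivative f).eval z‖| :=
    Finset.sum_congr rfl fun z hz => by
      rw [rootMultiplicity_eq_one hsq hz, Nat.cast_one, one_mul, taylorDeriv_one]
  have hsep0 : 0 ≤ ∑ z ∈ rootSet f, |Real.log (sep z f)| :=
    Finset.sum_nonneg fun _ _ => abs_nonneg _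
  have hgd0 : 0 ≤ ∑ z ∈ rootSet f, |Real.log ‖(derivative f).eval z‖| :=
    Finset.sum_nonneg fun _ _ => abs_nonneg _
  have h1 : logsep f ≤ 1 + ∑ z ∈ rootSet f, |Real.log (sep z f)| := by
    rw [logsep, hsep]
    exact max_le (by linarith) (by linarith)
  have h2 : logGDiscHat f ≤ 1 + ∑ z ∈ rootSet f, |Real.log ‖(derivative f).eval z‖| := by
    rw [logGDiscHat, hgd]
    exact max_le (by linarith) (by linarith)
  have h3 := sum_abs_log_norm_eval_derivative_le hsq hn
  have h4 := sum_abs_log_sep_le hsq hn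
  -- Since `T ≥ 2n`, the `6 n log n` in `h7` costs `3 T log(T + 2)`; with `12 T` this gives the
  -- constant 15.
  have h5 : 2 * ((f.natDegree : ℝ) * Real.log f.natDegree) ≤ T * Real.log (T + 2) := by
    have := mul_le_mul hTn hlogT hlogn (by linarith)
    linarith
  have h6 : T ≤ T * Real.log (T + 2) := le_mul_of_one_le_right (by linarith) hlog1
  have h7 : logsep f + logGDiscHat f ≤
      12 * T + 6 * ((f.natDegree : ℝ) * Real.log f.natDegree) := by
    linarith
  linarith

end RootSep

/-- Part (a) is an `O`-bound and part (b) an `O`-bound up to a power of a logarithm, both with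
absolute constants, uniformly in the degree `n` and in `f`. Mathlib's `Polynomial.discr` agrees
up to sign with `Res(f, f') / lc(f)`. -/
theorem mainTheorem7 :
    (∃ c : ℝ, 0 < c ∧ ∀ (n : ℕ) (f : Polynomial ℂ), f.degree = (n : WithBot ℕ) →
      RootSep.logsep f ≤
        c * ((n : ℝ) * ((n : ℝ) + RootSep.logLen f + RootSep.logMeaHat f)
          + RootSep.logGDiscHat f)) ∧
    (∃ (c : ℝ) (k : ℕ), 0 < c ∧ ∀ (n : ℕ) (f : Polynomial ℂ), 1 ≤ n →
      f.degree = (n : WithBot ℕ) → Squarefree f →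
      RootSep.logsep f + RootSep.logGDiscHat f ≤
        c * ((n : ℝ) * (RootSep.logLen f + RootSep.logMeaHat f) + |Real.log ‖f.discr‖|)
          * (Real.log ((n : ℝ) * (RootSep.logLen f + RootSep.logMeaHat f)
              + |Real.log ‖f.discr‖| + 2)) ^ k) := by
  refine ⟨⟨5, by norm_num, fun n f hf => ?_⟩, ⟨15, 1, by norm_num, fun n f hn hf hsq => ?_⟩⟩
  · obtain rfl := natDegree_eq_of_degree_eq_some hf
    exact RootSep.logsep_le (ne_zero_of_degree_gt (n := ⊥) (by rw [hf]; exact WithBot.bot_lt_coe _))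
  · obtain rfl := natDegree_eq_of_degree_eq_some hf
    rw [pow_one]
    exact RootSep.logsep_add_logGDiscHat_le hsq hn rfl
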